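/- Let $n\ge 1$ and let $\mathcal H$ be a downset of subsets of $[n]=\{1,\dots,n\}$ (that is, $A\in\mathcal H$ and $B\subseteq A$ imply $B\in\mathcal H$), all of whose members have size at most $3$. A family is intersecting if $A\cap B\ne\emptyset$ for all members $A,B$ (including $A=B$); the star of $\mathcal H$ centered at $x\in[n]$ is $\mathcal H_x=\{A\in\mathcal H: x\in A\}$. Then $\mathcal H$ is EKR: the maximum size of an intersecting subfamily of $\mathcal H$ equals $\max_{x\in[n]}|\mathcal H_x|$. Moreover, $\mathcal H$ is strictly EKR, i.e. every intersecting subfamily of $\mathcal H$ of maximum size equals $\mathcal H_x$ for some $x\in[n]$, unless one of the following holds, and in each of these cases it is not strictly EKR. (1) There is a set $K\subseteq[n]$ with $|K|=4$ such that $\binom{K}{3}\subseteq\mathcal H$, every $A\in\mathcal H$ satisfies $A\subseteq K$ or $A\cap K=\emptyset$, and the largest star in $\mathcal H$ has size $7$. (2) There are a set $K\subseteq[n]$ with $|K|=3$ and a (possibly empty) set $M\subseteq[n]\setminus K$ such that the family $\mathcal Z=\binom{K}{2}\cup\{Z\in\binom{K\cup M}{3}: |Z\cap K|=2\}$ is contained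 in $\mathcal H$, and either (a) $K\notin\mathcal H$ and the largest star in $\mathcal H$ has size $|\mathcal Z|=3|M|+3$, or (b) $K\in\mathcal H$ and the largest star in $\mathcal H$ has size $|\mathcal Z|+1=3|M|+4$. -/

import Mathlib

namespace Chvatal

variable {n : ℕ}

/-- A family is intersecting if any two of its members (possibly equal) have a common point.
In particular no intersecting family contains the empty set, and the empty family is
intersecting. -/
def IsIntersecting (F : Finset (Finset (Fin n))) : Prop :=
  ∀ A ∈ F, ∀ B ∈ F, (A ∩ B).Nonempty

instance instDecidableIsIntersecting (F : Finset (Finset (Fin n))) :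
    Decidable (IsIntersecting F) :=
  inferInstanceAs (Decidable (∀ A ∈ F, ∀ B ∈ F, (A ∩ B).Nonempty))

/-- The `F`-star centered at `x`: all members of `F` that contain `x`. -/
def star (F : Finset (Finset (Fin n))) (x : Fin n) : Finset (Finset (Fin n)) :=
  F.filter (fun A => x ∈ A)

/-- The size of the largest intersecting subfamily of `F`. -/
def maxIntersecting (F : Finset (Finset (Fin n))) : ℕ :=
  (F.powerset.filter IsIntersecting).sup Finset.card

/-- The size of the largest star of `F`. -/
def maxStar (F : Finset (Finset (Fin n))) : ℕ :=
  (Finset.univ : Finset (Fin n)).sup (fun x => (star F x).card)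

/-- `F` is EKR: its largest star is as large as its largest intersecting subfamily. -/
def IsEKR (F : Finset (Finset (Fin n))) : Prop :=
  maxIntersecting F = maxStar F

/-- `F` is strictly EKR: every largest intersecting subfamily of `F` is an `F`-star. -/
def IsStrictlyEKR (F : Finset (Finset (Fin n))) : Prop :=
  ∀ I : Finset (Finset (Fin n)), I ⊆ F → IsIntersecting I → I.card = maxIntersecting F →
    ∃ x : Fin n, I = star F x

/-- First exceptional configuration: an isolated 4-set. -/
def IsFourSetException (H : Finset (Finset (Fin n))) : Prop :=
  ∃ K : Finset (Fin n), K.card = 4 ∧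
    K.powersetCard 3 ⊆ H ∧
    (∀ A ∈ H, A ⊆ K ∨ Disjoint K A) ∧
    maxStar H = 7

/-- All 2-subsets of `K`, and all 3-subsets of `K ∪ M` meeting `K` in exactly two points. -/
def triangleFamily (K M : Finset (Fin n)) : Finset (Finset (Fin n)) :=
  K.powersetCard 2 ∪ ((K ∪ M).powersetCard 3).filter (fun Z => (Z ∩ K).card = 2)

/-- Second exceptional configuration: a triangle-based family (`M` may be empty). -/
def IsTriangleException (H : Finset (Finset (Fin n))) : Prop :=
  ∃ K M : Finset (Fin n), K.card = 3 ∧ Disjoint M K ∧ triangleFamily K M ⊆ H ∧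
    ((K ∉ H ∧ maxStar H = (triangleFamily K M).card ∧
        (triangleFamily K M).card = 3 * M.card + 3) ∨
     (K ∈ H ∧ maxStar H = (triangleFamily K M).card + 1 ∧
        (triangleFamily K M).card + 1 = 3 * M.card + 4))

end Chvatal

namespace Chvatal

variable {n : ℕ}

/-! Suppose `I` is intersecting and lies in no star. To compare `I` with the star of `H` at `x`,
discard the members missing `x`. Since `H` is a downset, that star also contains `{x}` and the pair
`{x, v}` for every free point `v`. So `I` is smaller than the star as soon as at most as many
members miss `x` as there are free points at `x` (`card_lt_maxStar_of_missed_le`).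

If `I` has at most one pair, such an `x` always exists. When two points nearly cover `I`, their
links are cross-intersecting graphs, and one graph has at most as many edges as the other has
vertices (`cross_intersecting_graphs`). Otherwise all codegrees are at most 2, and a point of
maximum degree works by double counting (`exists_missed_le_of_triples`).

If `I` has two pairs, either the same comparison works at their common point, or adding or swapping
in one pair gives a triangle of pairs on a triple `K`. Then every member has two points in `K`.
Comparing with the stars at all three points of `K` leaves equality only in the triangle exception
(`card_twoMeeting`). -/

/-- The members of `I` that avoid `x`. -/
def missed (I : Finset (Finset (Fin n))) (x : Fin n) : Finset (Finset (Fin n)) :=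
  I.filter (fun A => x ∉ A)

/-- The points `v` that occur together with `x` in a member of `I`, but for which the pair
`{x, v}` is not itself a member. -/
def freeNbrs (I : Finset (Finset (Fin n))) (x : Fin n) : Finset (Fin n) :=
  Finset.univ.filter (fun v => v ≠ x ∧ {x, v} ∉ I ∧ ∃ A ∈ I, x ∈ A ∧ v ∈ A)

/-! ### Comparing an intersecting family with a star -/

theorem mem_star {F : Finset (Finset (Fin n))} {x : Fin n} {A : Finset (Fin n)} :
    A ∈ star F x ↔ A ∈ F ∧ x ∈ A := by simp [star]

theorem mem_missed {F : Finset (Finset (Fin n))} {x : Fin n} {A : Finset (Fin n)} :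
    A ∈ missed F x ↔ A ∈ F ∧ x ∉ A := by simp [missed]

theorem mem_freeNbrs {I : Finset (Finset (Fin n))} {x v : Fin n} :
    v ∈ freeNbrs I x ↔ v ≠ x ∧ {x, v} ∉ I ∧ ∃ A ∈ I, x ∈ A ∧ v ∈ A := by simp [freeNbrs]

theorem card_star_add_card_missed (I : Finset (Finset (Fin n))) (x : Fin n) :
    (star I x).card + (missed I x).card = I.card :=
  Finset.card_filter_add_card_filter_not _

theorem card_star_le_maxStar (H : Finset (Finset (Fin n))) (x : Fin n) :
    (star H x).card ≤ maxStar H :=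
  Finset.le_sup (f := fun x => (star H x).card) (Finset.mem_univ x)

/-- The star of `H` at `x` contains the star of `I`, the singleton and all free pairs. -/
theorem card_add_card_freeNbrs_lt {H I : Finset (Finset (Fin n))} {x : Fin n}
    (hdown : ∀ A ∈ H, ∀ B : Finset (Fin n), B ⊆ A → B ∈ H) (hIH : I ⊆ H)
    (hx : {x} ∉ I) (hex : ∃ A ∈ I, x ∈ A) :
    I.card + (freeNbrs I x).card < (star H x).card + (missed I x).card := by
  classical
  have hsub : insert {x} (star I x ∪ (freeNbrs I x).image (fun v => ({x, v} : Finset (Fin n))))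
      ⊆ star H x := by
    intro A hA
    rw [Finset.mem_insert, Finset.mem_union, Finset.mem_image] at hA
    rw [mem_star]
    rcases hA with rfl | hA | ⟨v, hv, rfl⟩
    · obtain ⟨A, hA, hxA⟩ := hex
      exact ⟨hdown A (hIH hA) _ (by simpa using hxA), by simp⟩
    · rw [mem_star] at hA
      exact ⟨hIH hA.1, hA.2⟩
    · obtain ⟨-, -, A, hA, hxA, hvA⟩ := mem_freeNbrs.1 hv
      refine ⟨hdown A (hIH hA) _ ?_, by simp⟩
      intro z hz
      simp only [Finset.mem_insert, Finset.mem_singleton] at hz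
      rcases hz with rfl | rfl <;> assumption
  have hcard := Finset.card_le_card hsub
  have hinj : ((freeNbrs I x).image (fun v => ({x, v} : Finset (Fin n)))).card
      = (freeNbrs I x).card := by
    apply Finset.card_image_of_injOn
    intro v hv w hw h
    have hv := (mem_freeNbrs.1 hv).1
    have : v ∈ ({x, w} : Finset (Fin n)) := by
      rw [← show ({x, v} : Finset (Fin n)) = {x, w} from h]; simp
    simpa [hv] using this
  rw [Finset.card_insert_of_notMem, Finset.card_union_of_disjoint, hinj] at hcard
  · have := card_star_add_card_missed I x
    omega
  · rw [Finset.disjoint_left]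
    intro A hA hA'
    obtain ⟨v, hv, rfl⟩ := Finset.mem_image.1 hA'
    exact (mem_freeNbrs.1 hv).2.1 (mem_star.1 hA).1
  · rw [Finset.mem_union, Finset.mem_image, not_or]
    refine ⟨fun h => hx (mem_star.1 h).1, ?_⟩
    rintro ⟨v, hv, h⟩
    have : v ∈ ({x} : Finset (Fin n)) := by rw [← h]; simp
    exact (mem_freeNbrs.1 hv).1 (by simpa using this)

theorem card_lt_maxStar_of_missed_le {H I : Finset (Finset (Fin n))} {x : Fin n}
    (hdown : ∀ A ∈ H, ∀ B : Finset (Fin n), B ⊆ A → B ∈ H) (hIH : I ⊆ H)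
    (hI : I.Nonempty) (hx : {x} ∉ I) (h : (missed I x).card ≤ (freeNbrs I x).card) :
    I.card < maxStar H := by
  -- If no member contained `x`, all of `I` would be missed and no point free, forcing `I` to be
  -- empty.
  have hex : ∃ A ∈ I, x ∈ A := by
    by_contra! hno
    have h1 : missed I x = I := Finset.filter_true_of_mem hno
    have h2 : freeNbrs I x = ∅ := by
      refine Finset.eq_empty_of_forall_notMem fun v hv => ?_
      obtain ⟨-, -, A, hA, hxA, -⟩ := mem_freeNbrs.1 hv
      exact hno A hA hxA
    rw [h1, h2] at h
    have := hI.card_pos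
    simp at h
    simp [h] at this
  have h1 := card_add_card_freeNbrs_lt hdown hIH hx hex
  have h2 := card_star_le_maxStar H x
  omega

/-! ### Cross-intersecting graphs -/

/-- A graph without two disjoint edges has at most as many edges as vertices. -/
theorem card_le_card_vertices_of_intersecting {α : Type*} [DecidableEq α]
    (G : Finset (Finset α)) (h2 : ∀ e ∈ G, e.card = 2)
    (hInt : ∀ e ∈ G, ∀ f ∈ G, (e ∩ f).Nonempty) : G.card ≤ (G.biUnion id).card := by
  rcases G.eq_empty_or_nonempty with rfl | ⟨e, he⟩
  · simp
  obtain ⟨a, b, hab, rfl⟩ := Finset.card_eq_two.1 (h2 e he)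
  set V := G.biUnion id with hV
  have hmem : ∀ {v w}, {v, w} ∈ G → v ∈ V ∧ w ∈ V := by
    intro v w h
    constructor <;> exact Finset.mem_biUnion.2 ⟨_, h, by simp⟩
  set A := V.filter (fun v => v ≠ a ∧ v ≠ b ∧ {a, v} ∈ G) with hA
  set B := V.filter (fun v => v ≠ a ∧ v ≠ b ∧ {b, v} ∈ G) with hB
  have hG : G ⊆ insert {a, b} (A.image (fun v => {a, v}) ∪ B.image (fun v => {b, v})) := by
    intro f hf
    have hfab := hInt _ he _ hf
    obtain ⟨u, v, huv, rfl⟩ := Finset.card_eq_two.1 (h2 f hf)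
    have h1 := hmem hf
    have hf' : {v, u} ∈ G := by rwa [Finset.pair_comm]
    have hpc := Finset.pair_comm u v
    have hpc' := Finset.pair_comm a b
    simp only [Finset.mem_insert, Finset.mem_union, Finset.mem_image, hA, hB, Finset.mem_filter]
    obtain ⟨z, hz⟩ := hfab
    simp only [Finset.mem_inter, Finset.mem_insert, Finset.mem_singleton] at hz
    grind
  -- Distinct `v`, `w` in both sets would give disjoint edges `{a, v}` and `{b, w}`. Hence there are
  -- at most `1 + |A| + |B| ≤ 2 + |A ∪ B|` edges, and the right side counts vertices.
  have hAB : (A ∩ B).card ≤ 1 := by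
    rw [Finset.card_le_one]
    intro v hv w hw
    simp only [hA, hB, Finset.mem_inter, Finset.mem_filter] at hv hw
    obtain ⟨z, hz⟩ := hInt _ hv.1.2.2.2 _ hw.2.2.2.2
    simp only [Finset.mem_inter, Finset.mem_insert, Finset.mem_singleton] at hz
    grind
  have hVsub : insert a (insert b (A ∪ B)) ⊆ V := by
    intro z hz
    simp only [hA, hB, Finset.mem_insert, Finset.mem_union, Finset.mem_filter] at hz
    have := hmem he
    grind
  have c1 := Finset.card_le_card hG
  have c2 := Finset.card_le_card hVsub
  rw [Finset.card_insert_of_notMem, Finset.card_insert_of_notMem] at c2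
  · have c3 := Finset.card_union_add_card_inter A B
    have c4 := Finset.card_insert_le ({a, b} : Finset α)
      (A.image (fun v => {a, v}) ∪ B.image (fun v => {b, v}))
    have c5 := Finset.card_union_le (A.image (fun v => ({a, v} : Finset α)))
      (B.image (fun v => {b, v}))
    have c6 := Finset.card_image_le (s := A) (f := fun v => ({a, v} : Finset α))
    have c7 := Finset.card_image_le (s := B) (f := fun v => ({b, v} : Finset α))
    omega
  · simp [hA, hB]
  · simp [hA, hB, hab]

/-- If `G` has two disjoint edges, then at most four edges meet all edges of `G`. -/
theorem card_le_card_vertices_of_disjoint_edges {α : Type*} [DecidableEq α]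
    {G G' : Finset (Finset α)} (h2 : ∀ e ∈ G, e.card = 2) (h2' : ∀ e ∈ G', e.card = 2)
    (hcross : ∀ e ∈ G, ∀ f ∈ G', (e ∩ f).Nonempty) {e f : Finset α} (he : e ∈ G) (hf : f ∈ G)
    (hef : ¬ (e ∩ f).Nonempty) : G'.card ≤ (G.biUnion id).card := by
  have hdis : Disjoint e f := by
    rw [Finset.disjoint_iff_inter_eq_empty]; exact Finset.not_nonempty_iff_eq_empty.1 hef
  have hV : e ∪ f ⊆ G.biUnion id := Finset.union_subset
    (Finset.subset_biUnion_of_mem id he) (Finset.subset_biUnion_of_mem id hf)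
  have c1 := Finset.card_le_card hV
  rw [Finset.card_union_of_disjoint hdis, h2 e he, h2 f hf] at c1
  have hsub : G' ⊆ (e ×ˢ f).image (fun p => {p.1, p.2}) := by
    intro g hg
    obtain ⟨u, hu⟩ := hcross e he g hg
    obtain ⟨v, hv⟩ := hcross f hf g hg
    rw [Finset.mem_inter] at hu hv
    refine Finset.mem_image.2 ⟨(u, v), Finset.mem_product.2 ⟨hu.1, hv.1⟩, ?_⟩
    have huv : u ≠ v := fun h => Finset.disjoint_left.1 hdis hu.1 (h ▸ hv.1)
    apply Finset.eq_of_subset_of_card_le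
    · intro z hz
      simp only [Finset.mem_insert, Finset.mem_singleton] at hz
      rcases hz with rfl | rfl
      exacts [hu.2, hv.2]
    · rw [h2' g hg, Finset.card_pair huv]
  have c2 := (Finset.card_le_card hsub).trans Finset.card_image_le
  rw [Finset.card_product, h2 e he, h2 f hf] at c2
  omega

/-- If both graphs are intersecting, each has at most as many edges as vertices, so the one with
more vertices bounds the other. If one has two disjoint edges, it has at least four vertices and the
other at most four edges. -/
theorem cross_intersecting_graphs {α : Type*} [DecidableEq α]
    {G G' : Finset (Finset α)} (h2 : ∀ e ∈ G, e.card = 2) (h2' : ∀ e ∈ G', e.card = 2)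
    (hcross : ∀ e ∈ G, ∀ f ∈ G', (e ∩ f).Nonempty) :
    G'.card ≤ (G.biUnion id).card ∨ G.card ≤ (G'.biUnion id).card := by
  by_cases hG : ∀ e ∈ G, ∀ f ∈ G, (e ∩ f).Nonempty
  · by_cases hG' : ∀ e ∈ G', ∀ f ∈ G', (e ∩ f).Nonempty
    · have c1 := card_le_card_vertices_of_intersecting G h2 hG
      have c2 := card_le_card_vertices_of_intersecting G' h2' hG'
      omega
    · push Not at hG'
      obtain ⟨e, he, f, hf, hef⟩ := hG'
      refine Or.inr (card_le_card_vertices_of_disjoint_edges h2' h2 ?_ he hf (by simp [hef]))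
      intro e he f hf
      rw [Finset.inter_comm]
      exact hcross f hf e he
  · push Not at hG
    obtain ⟨e, he, f, hf, hef⟩ := hG
    exact Or.inl (card_le_card_vertices_of_disjoint_edges h2 h2' hcross he hf (by simp [hef]))

/-! ### Families nearly covered by two points -/

/-- The links at `x` of the members of `I` that contain `x` but not `y`. -/
def linkAvoiding (I : Finset (Finset (Fin n))) (x y : Fin n) : Finset (Finset (Fin n)) :=
  (I.filter (fun A => x ∈ A ∧ y ∉ A)).image (fun A => A.erase x)

theorem card_linkAvoiding (I : Finset (Finset (Fin n))) (x y : Fin n) :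
    (linkAvoiding I x y).card = (I.filter (fun A => x ∈ A ∧ y ∉ A)).card := by
  apply Finset.card_image_of_injOn
  intro A hA B hB h
  have hA := (Finset.mem_filter.1 hA).2.1
  have hB := (Finset.mem_filter.1 hB).2.1
  rw [← Finset.insert_erase hA, ← Finset.insert_erase hB,
    show A.erase x = B.erase x from h]

/-- `I` consists of triples and possibly the pair `{x, y}`, and is (nearly) covered by it. -/
def NearlyCovered (I : Finset (Finset (Fin n))) (x y : Fin n) : Prop :=
  (∀ A ∈ I, A.card = 3 ∨ A = {x, y}) ∧
    ((∀ A ∈ I, x ∈ A ∨ y ∈ A) ∨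
      ((I.filter (fun A => x ∉ A ∧ y ∉ A)).card ≤ 1 ∧ {x, y} ∉ I ∧ ∃ A ∈ I, x ∈ A ∧ y ∈ A))

theorem NearlyCovered.symm {I : Finset (Finset (Fin n))} {x y : Fin n}
    (h : NearlyCovered I x y) : NearlyCovered I y x := by
  unfold NearlyCovered at *
  rw [Finset.pair_comm y x]
  simpa only [and_comm, or_comm] using h

/-- Vertices of the link at `x` are free, because `{x, y}` is the only pair `I` can contain. A
possible extra member avoiding both points is paid for by `y`, which is then free as well. -/
theorem NearlyCovered.missed_le {I : Finset (Finset (Fin n))} {x y : Fin n} (hxy : x ≠ y)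
    (h : NearlyCovered I x y)
    (hle : (linkAvoiding I y x).card ≤ ((linkAvoiding I x y).biUnion id).card) :
    (missed I x).card ≤ (freeNbrs I x).card := by
  obtain ⟨h3, hcov⟩ := h
  have hsub : (linkAvoiding I x y).biUnion id ⊆ (freeNbrs I x).erase y := by
    intro v hv
    simp only [linkAvoiding, Finset.mem_biUnion, Finset.mem_image, Finset.mem_filter, id] at hv
    obtain ⟨_, ⟨A, ⟨hA, hxA, hyA⟩, rfl⟩, hvA⟩ := hv
    rw [Finset.mem_erase] at hvA
    have hvy : v ≠ y := by rintro rfl; exact hyA hvA.2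
    refine Finset.mem_erase.2 ⟨hvy, mem_freeNbrs.2 ⟨hvA.1, fun hxv => ?_, A, hA, hxA, hvA.2⟩⟩
    rcases h3 _ hxv with hc | hc
    · rw [Finset.card_pair hvA.1.symm] at hc
      omega
    · have : v ∈ ({x, y} : Finset (Fin n)) := by rw [← hc]; simp
      simp [hvA.1, hvy] at this
  have c1 := Finset.card_le_card hsub
  have c2 : (missed I x).card = (I.filter (fun A => y ∈ A ∧ x ∉ A)).card +
      (I.filter (fun A => x ∉ A ∧ y ∉ A)).card := by
    rw [← Finset.card_filter_add_card_filter_not (s := missed I x) (fun A => y ∈ A), missed,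
      Finset.filter_filter, Finset.filter_filter]
    simp only [and_comm]
  rw [card_linkAvoiding] at hle
  rcases hcov with hcov | ⟨hm, hxyI, A, hA, hxA, hyA⟩
  · have : I.filter (fun A => x ∉ A ∧ y ∉ A) = ∅ := by
      apply Finset.filter_false_of_mem
      intro A hA
      have := hcov A hA
      tauto
    rw [this, Finset.card_empty] at c2
    have c3 := Finset.card_le_card (Finset.erase_subset y (freeNbrs I x))
    omega
  · have hy : y ∈ freeNbrs I x := mem_freeNbrs.2 ⟨hxy.symm, hxyI, A, hA, hxA, hyA⟩
    have c3 := Finset.card_erase_add_one hy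
    omega

theorem NearlyCovered.exists_missed_le {I : Finset (Finset (Fin n))} {x y : Fin n} (hxy : x ≠ y)
    (hInt : IsIntersecting I) (h : NearlyCovered I x y) :
    ∃ z, (missed I z).card ≤ (freeNbrs I z).card := by
  have htwo : ∀ {x y : Fin n}, NearlyCovered I x y → ∀ e ∈ linkAvoiding I x y, e.card = 2 := by
    intro x y h e he
    obtain ⟨A, hA, rfl⟩ := Finset.mem_image.1 he
    obtain ⟨hA, hxA, hyA⟩ := Finset.mem_filter.1 hA
    rcases h.1 A hA with hc | rfl
    · rw [Finset.card_erase_of_mem hxA, hc]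
    · simp at hyA
  have hcross : ∀ e ∈ linkAvoiding I x y, ∀ f ∈ linkAvoiding I y x, (e ∩ f).Nonempty := by
    intro e he f hf
    obtain ⟨A, hA, rfl⟩ := Finset.mem_image.1 he
    obtain ⟨B, hB, rfl⟩ := Finset.mem_image.1 hf
    obtain ⟨hA, hxA, hyA⟩ := Finset.mem_filter.1 hA
    obtain ⟨hB, hyB, hxB⟩ := Finset.mem_filter.1 hB
    obtain ⟨z, hz⟩ := hInt A hA B hB
    rw [Finset.mem_inter] at hz
    refine ⟨z, Finset.mem_inter.2 ⟨Finset.mem_erase.2 ⟨?_, hz.1⟩, Finset.mem_erase.2 ⟨?_, hz.2⟩⟩⟩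
    · rintro rfl; exact hxB hz.2
    · rintro rfl; exact hyA hz.1
  rcases cross_intersecting_graphs (htwo h) (htwo h.symm) hcross with hle | hle
  · exact ⟨x, h.missed_le hxy hle⟩
  · exact ⟨y, h.symm.missed_le hxy.symm hle⟩

/-! ### Codegrees in intersecting families of triples -/

/-- The number of members of `I` containing both `x` and `y`. -/
def codegree (I : Finset (Finset (Fin n))) (x y : Fin n) : ℕ :=
  (I.filter (fun A => x ∈ A ∧ y ∈ A)).card

/-- The points completing `{x, y}` to a triple of `I`. -/
def thirdPoints (I : Finset (Finset (Fin n))) (x y : Fin n) : Finset (Fin n) :=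
  Finset.univ.filter (fun z => z ≠ x ∧ z ≠ y ∧ {x, y, z} ∈ I)

theorem codegree_le_card_thirdPoints {I : Finset (Finset (Fin n))}
    (h3 : ∀ A ∈ I, A.card = 3) {x y : Fin n} (hxy : x ≠ y) :
    codegree I x y ≤ (thirdPoints I x y).card := by
  refine (Finset.card_le_card (t := (thirdPoints I x y).image (fun z => {x, y, z})) ?_).trans
    Finset.card_image_le
  intro A hA
  obtain ⟨hA, hxA, hyA⟩ := Finset.mem_filter.1 hA
  have hsub : ({x, y} : Finset (Fin n)) ⊆ A := by
    intro z hz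
    simp only [Finset.mem_insert, Finset.mem_singleton] at hz
    rcases hz with rfl | rfl <;> assumption
  have hc : (A \ {x, y}).card = 1 := by
    rw [Finset.card_sdiff_of_subset hsub, h3 A hA, Finset.card_pair hxy]
  obtain ⟨z, hz⟩ := Finset.card_eq_one.1 hc
  have hzA : z ∈ A \ {x, y} := by rw [hz]; simp
  have hAeq : {x, y, z} = A := by
    rw [← Finset.sdiff_union_of_subset hsub, hz]
    ext w
    simp only [Finset.mem_insert, Finset.mem_union, Finset.mem_singleton]
    tauto
  simp only [Finset.mem_sdiff, Finset.mem_insert, Finset.mem_singleton, not_or] at hzA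
  refine Finset.mem_image.2 ⟨z, ?_, hAeq⟩
  simp only [thirdPoints, Finset.mem_filter, Finset.mem_univ, true_and]
  exact ⟨hzA.2.1, hzA.2.2, hAeq ▸ hA⟩

theorem thirdPoints_subset {I : Finset (Finset (Fin n))} (hInt : IsIntersecting I)
    {x y : Fin n} {B : Finset (Fin n)} (hB : B ∈ I) (hx : x ∉ B) (hy : y ∉ B) :
    thirdPoints I x y ⊆ B := by
  intro z hz
  simp only [thirdPoints, Finset.mem_filter, Finset.mem_univ, true_and] at hz
  obtain ⟨w, hw⟩ := hInt _ hz.2.2 _ hB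
  simp only [Finset.mem_inter, Finset.mem_insert, Finset.mem_singleton] at hw
  rcases hw with ⟨rfl | rfl | rfl, hw⟩
  exacts [absurd hw hx, absurd hw hy, hw]

/-- A member avoiding `x` and `y` contains every third point of the pair. Three third points would
determine it, so the pair would nearly cover `I`. -/
theorem codegree_le_two {I : Finset (Finset (Fin n))} (hInt : IsIntersecting I)
    (h3 : ∀ A ∈ I, A.card = 3) {x y : Fin n} (hxy : x ≠ y) (hnc : ¬ NearlyCovered I x y) :
    codegree I x y ≤ 2 := by
  by_contra! hc
  refine hnc ⟨fun A hA => Or.inl (h3 A hA), Or.inr ⟨?_, fun h => ?_, ?_⟩⟩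
  · have heq : ∀ B ∈ I.filter (fun A => x ∉ A ∧ y ∉ A), B = thirdPoints I x y := by
      intro B hB
      obtain ⟨hB, hx, hy⟩ := Finset.mem_filter.1 hB
      refine (Finset.eq_of_subset_of_card_le (thirdPoints_subset hInt hB hx hy) ?_).symm
      have := codegree_le_card_thirdPoints h3 hxy
      rw [h3 B hB]
      omega
    rw [Finset.card_le_one]
    intro A hA B hB
    rw [heq A hA, heq B hB]
  · have := h3 _ h
    rw [Finset.card_pair hxy] at this
    omega
  · obtain ⟨A, hA⟩ := Finset.card_pos.1 (show 0 < codegree I x y by omega)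
    exact ⟨A, Finset.mem_filter.1 hA⟩

/-- Double count incidences: a triple through `x` has two further points, both free since `I`
contains no pairs, and each free point lies on at most `k` of these triples. -/
theorem two_mul_card_star_le {I : Finset (Finset (Fin n))} (h3 : ∀ A ∈ I, A.card = 3) {k : ℕ}
    {x : Fin n} (hk : ∀ v, v ≠ x → codegree I x v ≤ k) :
    2 * (star I x).card ≤ k * (freeNbrs I x).card := by
  have h := Finset.sum_card_bipartiteAbove_eq_sum_card_bipartiteBelow
    (s := star I x) (t := freeNbrs I x) (fun A v => v ∈ A)
  have hl : ∀ A ∈ star I x, (Finset.bipartiteAbove (fun A v => v ∈ A) (freeNbrs I x) A).card = 2 := by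
    intro A hA
    rw [mem_star] at hA
    have : Finset.bipartiteAbove (fun A v => v ∈ A) (freeNbrs I x) A = A.erase x := by
      ext v
      simp only [Finset.bipartiteAbove, Finset.mem_filter, mem_freeNbrs, Finset.mem_erase]
      constructor
      · rintro ⟨⟨h1, -⟩, h2⟩
        exact ⟨h1, h2⟩
      · rintro ⟨h1, h2⟩
        refine ⟨⟨h1, fun h => ?_, A, hA.1, hA.2, h2⟩, h2⟩
        have := h3 _ h
        rw [Finset.card_pair h1.symm] at this
        omega
    rw [this, Finset.card_erase_of_mem hA.2, h3 A hA.1]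
  have hr : ∀ v ∈ freeNbrs I x, (Finset.bipartiteBelow (fun A v => v ∈ A) (star I x) v).card ≤ k := by
    intro v hv
    refine le_trans (le_of_eq ?_) (hk v (mem_freeNbrs.1 hv).1)
    rw [codegree, Finset.bipartiteBelow, star, Finset.filter_filter]
  rw [Finset.sum_congr rfl hl, Finset.sum_const, smul_eq_mul] at h
  have h' := Finset.sum_le_card_nsmul _ _ k hr
  rw [← h, smul_eq_mul] at h'
  linarith

theorem card_add_codegree (I : Finset (Finset (Fin n))) (x y : Fin n) :
    I.card + codegree I x y =
      (star I x).card + (star I y).card + (I.filter (fun A => x ∉ A ∧ y ∉ A)).card := by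
  have h1 := Finset.card_union_add_card_inter (star I x) (star I y)
  have h2 := Finset.card_filter_add_card_filter_not (s := I) (fun A => x ∈ A ∨ y ∈ A)
  have h3 : star I x ∪ star I y = I.filter (fun A => x ∈ A ∨ y ∈ A) := by
    rw [star, star, Finset.filter_or]
  have h4 : star I x ∩ star I y = I.filter (fun A => x ∈ A ∧ y ∈ A) := by
    rw [star, star, Finset.filter_and]
  simp only [not_or] at h2
  rw [h3, h4] at h1
  rw [codegree]
  omega

/-- In an intersecting family of triples some point has as many neighbours as there are
members avoiding it. -/
theorem exists_missed_le_of_triples {I : Finset (Finset (Fin n))} (hInt : IsIntersecting I)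
    (h3 : ∀ A ∈ I, A.card = 3) (hne : I.Nonempty) :
    ∃ z, (missed I z).card ≤ (freeNbrs I z).card := by
  by_cases hnc : ∃ x y, x ≠ y ∧ NearlyCovered I x y
  · obtain ⟨x, y, hxy, h⟩ := hnc
    exact h.exists_missed_le hxy hInt
  push Not at hnc
  have hcod : ∀ x y, x ≠ y → codegree I x y ≤ 2 :=
    fun x y hxy => codegree_le_two hInt h3 hxy (hnc x y hxy)
  obtain ⟨E, hE⟩ := hne
  obtain ⟨w, -⟩ := Finset.card_pos.1 (show 0 < E.card by rw [h3 E hE]; omega)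
  obtain ⟨x, -, hx⟩ := Finset.exists_max_image Finset.univ (fun v => (star I v).card) ⟨w, by simp⟩
  refine ⟨x, ?_⟩
  have hm := card_star_add_card_missed I x
  -- Let `d` be the maximum degree, attained at `x`. With a pair of codegree 2, `|I| + 2 ≤ 2d + 2`,
  -- so at most `d` members miss `x`, and at least `d` points are free. With codegrees at most 1,
  -- `|I| ≤ 3d`, so at most `2d` members miss `x`, and at least `2d` points are free.
  by_cases htwo : ∃ u v, u ≠ v ∧ codegree I u v = 2
  · obtain ⟨u, v, huv, hc⟩ := htwo
    have hmiss : (I.filter (fun A => u ∉ A ∧ v ∉ A)).card ≤ 2 := by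
      have hZ := codegree_le_card_thirdPoints h3 huv
      rw [hc] at hZ
      obtain ⟨a, ha, b, hb, hab⟩ := Finset.one_lt_card.1 (show 1 < (thirdPoints I u v).card by omega)
      refine (Finset.card_le_card ?_).trans (hcod a b hab)
      intro B hB
      obtain ⟨hB, hu, hv⟩ := Finset.mem_filter.1 hB
      have hs := thirdPoints_subset hInt hB hu hv
      exact Finset.mem_filter.2 ⟨hB, hs ha, hs hb⟩
    have h1 := card_add_codegree I u v
    have h2 := two_mul_card_star_le h3 (x := x) (fun v hv => hcod x v hv.symm)
    have h4 := hx u (Finset.mem_univ u)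
    have h5 := hx v (Finset.mem_univ v)
    omega
  · push Not at htwo
    have h2 := two_mul_card_star_le h3 (k := 1) (x := x) (fun v hv => by
      have h1 := hcod x v hv.symm
      have h2 := htwo x v hv.symm
      omega)
    have hcover : I ⊆ E.biUnion (star I) := by
      intro A hA
      obtain ⟨v, hv⟩ := hInt A hA E hE
      rw [Finset.mem_inter] at hv
      exact Finset.mem_biUnion.2 ⟨v, hv.2, mem_star.2 ⟨hA, hv.1⟩⟩
    have h4 := (Finset.card_le_card hcover).trans
      (Finset.card_biUnion_le_card_mul E (star I) (star I x).card
        (fun v _ => hx v (Finset.mem_univ v)))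
    rw [h3 E hE] at h4
    omega

/-! ### Structure and size of the triangle family -/

theorem exists_eq_erase_of_card_two {K T : Finset (Fin n)} (hK : K.card = 3) (hT : T ⊆ K)
    (hc : T.card = 2) : ∃ v ∈ K, T = K.erase v := by
  have h1 : (K \ T).card = 1 := by rw [Finset.card_sdiff_of_subset hT, hK, hc]
  obtain ⟨v, hv⟩ := Finset.card_eq_one.1 h1
  have hvm : v ∈ K \ T := by rw [hv]; simp
  refine ⟨v, (Finset.mem_sdiff.1 hvm).1, ?_⟩
  rw [← Finset.sdiff_sdiff_eq_self hT, hv, Finset.sdiff_singleton_eq_erase]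

theorem eq_erase_or_insert {K Z : Finset (Fin n)} (hK : K.card = 3) (hZ : Z.card ≤ 3)
    (hc : (Z ∩ K).card = 2) :
    ∃ v ∈ K, Z = K.erase v ∨ ∃ m, m ∉ K ∧ Z = insert m (K.erase v) := by
  obtain ⟨v, hv, h⟩ := exists_eq_erase_of_card_two hK Finset.inter_subset_right hc
  refine ⟨v, hv, ?_⟩
  have h1 := Finset.card_inter_add_card_sdiff Z K
  have h2 : Z \ K ∪ Z ∩ K = Z := Finset.sdiff_union_inter Z K
  rcases (Z \ K).eq_empty_or_nonempty with h0 | h0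
  · left
    rw [← h2, h0, Finset.empty_union, h]
  · right
    have h3 := h0.card_pos
    obtain ⟨m, hm⟩ := Finset.card_eq_one.1 (show (Z \ K).card = 1 by omega)
    have hmm : m ∈ Z \ K := by rw [hm]; simp
    refine ⟨m, (Finset.mem_sdiff.1 hmm).2, ?_⟩
    rw [← h2, hm, h]
    rfl

theorem insert_erase_inter {K : Finset (Fin n)} {v m : Fin n} (hm : m ∉ K) :
    insert m (K.erase v) ∩ K = K.erase v := by
  rw [Finset.insert_inter_of_notMem hm, Finset.inter_eq_left]
  exact Finset.erase_subset v K

theorem triangleFamily_eq {K M : Finset (Fin n)} (hK : K.card = 3) (hMK : Disjoint M K) :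
    triangleFamily K M =
      K.image (fun v => K.erase v) ∪ (K ×ˢ M).image (fun p => insert p.2 (K.erase p.1)) := by
  have hKe : ∀ v ∈ K, (K.erase v).card = 2 := fun v hv => by
    rw [Finset.card_erase_of_mem hv, hK]
  unfold triangleFamily
  congr 1
  · ext T
    rw [Finset.mem_powersetCard, Finset.mem_image]
    constructor
    · rintro ⟨h1, h2⟩
      obtain ⟨v, hv, h⟩ := exists_eq_erase_of_card_two hK h1 h2
      exact ⟨v, hv, h.symm⟩
    · rintro ⟨v, hv, rfl⟩
      exact ⟨Finset.erase_subset _ _, hKe v hv⟩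
  · ext Z
    simp only [Finset.mem_filter, Finset.mem_powersetCard, Finset.mem_image, Finset.mem_product,
      Prod.exists]
    constructor
    · rintro ⟨⟨h1, h2⟩, h3⟩
      obtain ⟨v, hv, rfl | ⟨m, hm, rfl⟩⟩ := eq_erase_or_insert hK h2.le h3
      · have := hKe v hv
        omega
      · refine ⟨v, m, ⟨hv, ?_⟩, rfl⟩
        have := h1 (Finset.mem_insert_self m _)
        simpa [hm] using this
    · rintro ⟨v, m, ⟨hv, hm⟩, rfl⟩
      have hmK : m ∉ K := Finset.disjoint_left.1 hMK hm
      rw [insert_erase_inter hmK, Finset.card_insert_of_notMem (by simp [hmK]), hKe v hv]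
      refine ⟨⟨?_, rfl⟩, rfl⟩
      intro z hz
      simp only [Finset.mem_insert, Finset.mem_erase] at hz
      rw [Finset.mem_union]
      rcases hz with rfl | hz
      exacts [Or.inr hm, Or.inl hz.2]

theorem card_triangleFamily {K M : Finset (Fin n)} (hK : K.card = 3) (hMK : Disjoint M K) :
    (triangleFamily K M).card = 3 * M.card + 3 := by
  have hmK : ∀ m ∈ M, m ∉ K := fun m hm => Finset.disjoint_left.1 hMK hm
  have hinj : ∀ v ∈ K, ∀ w ∈ K, K.erase v = K.erase w → v = w := by
    intro v hv w hw h
    by_contra hvw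
    have : v ∈ K.erase v := by rw [h]; exact Finset.mem_erase.2 ⟨hvw, hv⟩
    simp at this
  rw [triangleFamily_eq hK hMK, Finset.card_union_of_disjoint, Finset.card_image_of_injOn,
    Finset.card_image_of_injOn, Finset.card_product, hK]
  · ring
  · rintro ⟨v, m⟩ hp ⟨w, k⟩ hq h
    simp only [Finset.coe_product, Set.mem_prod, Finset.mem_coe] at hp hq
    have h : insert m (K.erase v) = insert k (K.erase w) := h
    have h1 : K.erase v = K.erase w := by
      rw [← insert_erase_inter (hmK m hp.2), h, insert_erase_inter (hmK k hq.2)]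
    have h2 : m ∈ insert k (K.erase w) := by rw [← h]; simp
    have h3 : m = k := by simpa [hmK m hp.2] using h2
    rw [hinj v hp.1 w hq.1 h1, h3]
  · exact fun v hv w hw h => hinj v hv w hw h
  · rw [Finset.disjoint_left]
    rintro Z h1 h2
    obtain ⟨v, hv, rfl⟩ := Finset.mem_image.1 h1
    obtain ⟨⟨w, m⟩, hp, h⟩ := Finset.mem_image.1 h2
    have : m ∈ K.erase v := by rw [← h]; simp
    exact hmK m (Finset.mem_product.1 hp).2 (Finset.mem_of_mem_erase this)

/-! ### Members meeting a triple twice -/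

/-- The members of `H` that contain at least two points of `K`. -/
def twoMeeting (H : Finset (Finset (Fin n))) (K : Finset (Fin n)) : Finset (Finset (Fin n)) :=
  H.filter (fun A => 2 ≤ (A ∩ K).card)

theorem mem_twoMeeting {H : Finset (Finset (Fin n))} {K A : Finset (Fin n)} :
    A ∈ twoMeeting H K ↔ A ∈ H ∧ 2 ≤ (A ∩ K).card := by simp [twoMeeting]

/-- The points outside `K` that together with `K.erase v` form a member of `H`. -/
def apexes (H : Finset (Finset (Fin n))) (K : Finset (Fin n)) (v : Fin n) : Finset (Fin n) :=
  Finset.univ.filter (fun m => m ∉ K ∧ insert m (K.erase v) ∈ H)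

theorem mem_apexes {H : Finset (Finset (Fin n))} {K : Finset (Fin n)} {v m : Fin n} :
    m ∈ apexes H K v ↔ m ∉ K ∧ insert m (K.erase v) ∈ H := by simp [apexes]

/-- Such a member contains `K.erase v`; the extra one is `K.erase v` itself. -/
theorem card_missed_twoMeeting_le {H : Finset (Finset (Fin n))} {K : Finset (Fin n)}
    (hthree : ∀ A ∈ H, A.card ≤ 3) (hK : K.card = 3) {v : Fin n} (hv : v ∈ K) :
    (missed (twoMeeting H K) v).card ≤ (apexes H K v).card + 1 := by
  have hsub : missed (twoMeeting H K) v ⊆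
      insert (K.erase v) ((apexes H K v).image (fun m => insert m (K.erase v))) := by
    intro A hA
    rw [mem_missed, mem_twoMeeting] at hA
    obtain ⟨⟨hAH, h2⟩, hvA⟩ := hA
    have h3 : A ∩ K ⊆ K.erase v := by
      intro z hz
      rw [Finset.mem_inter] at hz
      exact Finset.mem_erase.2 ⟨fun h => hvA (h ▸ hz.1), hz.2⟩
    have h4 := Finset.card_le_card h3
    rw [Finset.card_erase_of_mem hv, hK] at h4
    obtain ⟨w, hw, h⟩ := eq_erase_or_insert hK (hthree A hAH) (by omega)
    have hwv : v = w := by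
      by_contra hne
      have : v ∈ K.erase w := Finset.mem_erase.2 ⟨hne, hv⟩
      rcases h with rfl | ⟨m, hm, rfl⟩
      · exact hvA this
      · exact hvA (Finset.mem_insert_of_mem this)
    subst hwv
    rcases h with rfl | ⟨m, hm, rfl⟩
    · simp
    · exact Finset.mem_insert_of_mem
        (Finset.mem_image_of_mem (fun m => insert m (K.erase v)) (mem_apexes.2 ⟨hm, hAH⟩))
  refine (Finset.card_le_card hsub).trans ((Finset.card_insert_le _ _).trans ?_)
  have := Finset.card_image_le (s := apexes H K v) (f := fun m => insert m (K.erase v))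
  omega

theorem apexes_subset_freeNbrs {H : Finset (Finset (Fin n))} {K : Finset (Fin n)}
    (hK : K.card = 3) {u v : Fin n} (hu : u ∈ K) (hv : v ∈ K) (huv : v ≠ u) :
    apexes H K u ⊆ freeNbrs (twoMeeting H K) v := by
  intro m hm
  rw [mem_apexes] at hm
  refine mem_freeNbrs.2 ⟨fun h => hm.1 (h ▸ hv), fun h => ?_, _, mem_twoMeeting.2 ⟨hm.2, ?_⟩,
    Finset.mem_insert_of_mem (Finset.mem_erase.2 ⟨huv, hv⟩), Finset.mem_insert_self _ _⟩
  · have h1 := (mem_twoMeeting.1 h).2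
    have h2 : ({v, m} : Finset (Fin n)) ∩ K ⊆ {v} := by
      intro z hz
      simp only [Finset.mem_inter, Finset.mem_insert, Finset.mem_singleton] at hz ⊢
      rcases hz with ⟨rfl | rfl, hz⟩
      · rfl
      · exact absurd hz hm.1
    have h3 := Finset.card_le_card h2
    rw [Finset.card_singleton] at h3
    omega
  · rw [insert_erase_inter hm.1, Finset.card_erase_of_mem hu, hK]

/-- Either the family of members meeting `K` twice is smaller than a star, or it is a largest
star and `H` is a triangle exception. -/
theorem card_twoMeeting {H : Finset (Finset (Fin n))}
    (hdown : ∀ A ∈ H, ∀ B : Finset (Fin n), B ⊆ A → B ∈ H) (hthree : ∀ A ∈ H, A.card ≤ 3)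
    {K : Finset (Fin n)} (hK : K.card = 3) (hKH : K.powersetCard 2 ⊆ H) :
    (twoMeeting H K).card < maxStar H ∨
      ((twoMeeting H K).card ≤ maxStar H ∧ IsTriangleException H) := by
  rw [or_iff_not_imp_left]
  intro hlt
  push Not at hlt
  have hKe : ∀ v ∈ K, (K.erase v).card = 2 := fun v hv => by
    rw [Finset.card_erase_of_mem hv, hK]
  have hKeH : ∀ v ∈ K, K.erase v ∈ H := fun v hv =>
    hKH (Finset.mem_powersetCard.2 ⟨Finset.erase_subset _ _, hKe v hv⟩)
  have hthird : ∀ u v, ∃ w ∈ K, w ≠ u ∧ w ≠ v := by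
    intro u v
    have h1 : ({u, v} : Finset (Fin n)).card < K.card := by
      have := Finset.card_le_two (a := u) (b := v)
      omega
    obtain ⟨w, hw, hw'⟩ := Finset.exists_mem_notMem_of_card_lt_card h1
    simp only [Finset.mem_insert, Finset.mem_singleton, not_or] at hw'
    exact ⟨w, hw, hw'⟩
  -- The singleton `{v}` gained by the star offsets the missed pair `K.erase v`.
  have hkey : ∀ v ∈ K, (twoMeeting H K).card + (freeNbrs (twoMeeting H K) v).card
      ≤ (star H v).card + (apexes H K v).card := by
    intro v hv
    have h1 := card_add_card_freeNbrs_lt (I := twoMeeting H K) (x := v) hdown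
      (Finset.filter_subset _ _) (fun h => ?_) ?_
    · have h2 := card_missed_twoMeeting_le hthree hK hv
      omega
    · have h2 := (mem_twoMeeting.1 h).2
      have h3 := Finset.card_le_card (Finset.inter_subset_left (s₁ := {v}) (s₂ := K))
      rw [Finset.card_singleton] at h3
      omega
    · obtain ⟨u, hu, huv, -⟩ := hthird v v
      refine ⟨K.erase u, mem_twoMeeting.2 ⟨hKeH u hu, ?_⟩, Finset.mem_erase.2 ⟨huv.symm, hv⟩⟩
      rw [Finset.inter_eq_left.2 (Finset.erase_subset u K), hKe u hu]
  have hfree : ∀ v ∈ K, (freeNbrs (twoMeeting H K) v).card ≤ (apexes H K v).card := by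
    intro v hv
    have h1 := hkey v hv
    have h2 := card_star_le_maxStar H v
    omega
  -- With `w` the third point, `|free w| ≤ |apexes w| ≤ |free v| ≤ |apexes v|`. Since the apexes of
  -- `v` are free at `w`, both sets coincide, and the apexes of `u` are also free at `w`.
  have hle : ∀ u ∈ K, ∀ v ∈ K, u ≠ v → apexes H K u ⊆ apexes H K v := by
    intro u hu v hv huv
    obtain ⟨w, hw, hwu, hwv⟩ := hthird u v
    have h1 := apexes_subset_freeNbrs (H := H) hK hu hw hwu
    have h2 := apexes_subset_freeNbrs (H := H) hK hv hw hwv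
    have h3 := apexes_subset_freeNbrs (H := H) hK hw hv hwv.symm
    have h4 := Finset.card_le_card h3
    have h5 := hfree w hw
    have h6 := hfree v hv
    rw [Finset.eq_of_subset_of_card_le h2 (by omega)]
    exact h1
  obtain ⟨k, hk⟩ := Finset.card_pos.1 (show 0 < K.card by omega)
  set M := apexes H K k with hM
  have hMeq : ∀ v ∈ K, apexes H K v = M := by
    intro v hv
    by_cases h : v = k
    · rw [h]
    · exact (hle v hv k hk h).antisymm (hle k hk v hv (Ne.symm h))
  have hMK : Disjoint M K := by
    rw [Finset.disjoint_left]
    exact fun m hm => (mem_apexes.1 hm).1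
  have hmax : maxStar H = (twoMeeting H K).card := by
    refine le_antisymm hlt ?_
    obtain ⟨u, hu, huk, -⟩ := hthird k k
    have h1 := hkey k hk
    have h2 := Finset.card_le_card (apexes_subset_freeNbrs (H := H) hK hu hk huk.symm)
    have h3 := card_star_le_maxStar H k
    rw [hMeq u hu] at h2
    rw [hMeq k hk] at h1
    omega
  have hsubH : triangleFamily K M ⊆ H := by
    rw [triangleFamily_eq hK hMK]
    intro Z hZ
    rcases Finset.mem_union.1 hZ with hZ | hZ
    · obtain ⟨v, hv, rfl⟩ := Finset.mem_image.1 hZ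
      exact hKeH v hv
    · obtain ⟨⟨v, m⟩, hp, rfl⟩ := Finset.mem_image.1 hZ
      rw [Finset.mem_product] at hp
      have hm : m ∈ M := hp.2
      rw [← hMeq v hp.1] at hm
      exact (mem_apexes.1 hm).2
  have htwo : ∀ Z ∈ triangleFamily K M, (Z ∩ K).card = 2 := by
    intro Z hZ
    rcases Finset.mem_union.1 hZ with hZ | hZ
    · rw [Finset.mem_powersetCard] at hZ
      rw [Finset.inter_eq_left.2 hZ.1, hZ.2]
    · exact (Finset.mem_filter.1 hZ).2
  -- Only `K` itself can contain all of `K`; whether it belongs to `H` separates cases (a) and (b).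
  have hfilter : (twoMeeting H K).erase K = triangleFamily K M := by
    ext Z
    rw [Finset.mem_erase, mem_twoMeeting]
    constructor
    · rintro ⟨hne, hZ, h2⟩
      have h3 : (Z ∩ K).card = 2 := by
        have h4 := Finset.card_le_card (Finset.inter_subset_right (s₁ := Z) (s₂ := K))
        by_contra h5
        have h6 : Z ∩ K = K := Finset.eq_of_subset_of_card_le Finset.inter_subset_right (by omega)
        rw [Finset.inter_eq_right] at h6
        have h7 := hthree Z hZ
        exact hne (Finset.eq_of_subset_of_card_le h6 (by omega)).symm
      rw [triangleFamily_eq hK hMK, Finset.mem_union]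
      obtain ⟨v, hv, rfl | ⟨m, hm, rfl⟩⟩ := eq_erase_or_insert hK (hthree Z hZ) h3
      · exact Or.inl (Finset.mem_image_of_mem _ hv)
      · refine Or.inr (Finset.mem_image.2 ⟨(v, m), Finset.mem_product.2 ⟨hv, ?_⟩, rfl⟩)
        rw [← hMeq v hv]
        exact mem_apexes.2 ⟨hm, hZ⟩
    · intro hZ
      have h2 := htwo Z hZ
      refine ⟨?_, hsubH hZ, h2.ge⟩
      rintro rfl
      rw [Finset.inter_self] at h2
      omega
  have hcard := card_triangleFamily hK hMK
  refine ⟨hmax.ge, K, M, hK, hMK, hsubH, ?_⟩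
  by_cases hKm : K ∈ H
  · right
    have hmem : K ∈ twoMeeting H K := mem_twoMeeting.2 ⟨hKm, by rw [Finset.inter_self]; omega⟩
    refine ⟨hKm, ?_, by omega⟩
    rw [hmax, ← hfilter, Finset.card_erase_add_one hmem]
  · left
    refine ⟨hKm, ?_, hcard⟩
    rw [hmax, ← hfilter, Finset.erase_eq_of_notMem]
    exact fun h => hKm (mem_twoMeeting.1 h).1

/-! ### Intersecting families with at least two pairs -/

theorem card_le_of_triangle {H I : Finset (Finset (Fin n))}
    (hdown : ∀ A ∈ H, ∀ B : Finset (Fin n), B ⊆ A → B ∈ H) (hthree : ∀ A ∈ H, A.card ≤ 3)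
    (hIH : I ⊆ H) (hInt : IsIntersecting I) {a b c : Fin n} (hab : a ≠ b) (hac : a ≠ c)
    (hbc : b ≠ c) (h1 : {a, b} ∈ I) (h2 : {a, c} ∈ I) (h3 : {b, c} ∈ I) :
    I.card < maxStar H ∨ (I.card ≤ maxStar H ∧ IsTriangleException H) := by
  have hK : ({a, b, c} : Finset (Fin n)).card = 3 := Finset.card_eq_three.2
    ⟨a, b, c, hab, hac, hbc, rfl⟩
  have hKH : ({a, b, c} : Finset (Fin n)).powersetCard 2 ⊆ H := by
    intro T hT
    rw [Finset.mem_powersetCard] at hT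
    obtain ⟨v, hv, rfl⟩ := exists_eq_erase_of_card_two hK hT.1 hT.2
    simp only [Finset.mem_insert, Finset.mem_singleton] at hv
    rcases hv with rfl | rfl | rfl
    · convert hIH h3 using 1
      ext z; simp only [Finset.mem_erase, Finset.mem_insert, Finset.mem_singleton]; grind
    · convert hIH h2 using 1
      ext z; simp only [Finset.mem_erase, Finset.mem_insert, Finset.mem_singleton]; grind
    · convert hIH h1 using 1
      ext z; simp only [Finset.mem_erase, Finset.mem_insert, Finset.mem_singleton]; grind
  have hsub : I ⊆ twoMeeting H {a, b, c} := by
    intro A hA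
    refine mem_twoMeeting.2 ⟨hIH hA, ?_⟩
    obtain ⟨x, hx⟩ := hInt _ h1 A hA
    obtain ⟨y, hy⟩ := hInt _ h2 A hA
    obtain ⟨z, hz⟩ := hInt _ h3 A hA
    simp only [Finset.mem_inter, Finset.mem_insert, Finset.mem_singleton] at hx hy hz
    have : 1 < (A ∩ {a, b, c}).card := by
      rw [Finset.one_lt_card]
      simp only [Finset.mem_inter, Finset.mem_insert, Finset.mem_singleton]
      by_cases hxy : x = y
      · exact ⟨x, by grind, z, by grind, by grind⟩
      · exact ⟨x, by grind, y, by grind, hxy⟩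
    exact this
  have hc := Finset.card_le_card hsub
  rcases card_twoMeeting hdown hthree hK hKH with h | ⟨h, he⟩
  · exact Or.inl (by omega)
  · exact Or.inr ⟨by omega, he⟩

theorem isIntersecting_insert {I : Finset (Finset (Fin n))} (hInt : IsIntersecting I)
    {e : Finset (Fin n)} (he : e.Nonempty) (h : ∀ A ∈ I, (A ∩ e).Nonempty) :
    IsIntersecting (insert e I) := by
  intro A hA B hB
  rw [Finset.mem_insert] at hA hB
  rcases hA with rfl | hA <;> rcases hB with rfl | hB
  · rwa [Finset.inter_self]
  · rw [Finset.inter_comm]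
    exact h B hB
  · exact h A hA
  · exact hInt A hA B hB

theorem card_le_of_two_pairs {H I : Finset (Finset (Fin n))}
    (hdown : ∀ A ∈ H, ∀ B : Finset (Fin n), B ⊆ A → B ∈ H) (hthree : ∀ A ∈ H, A.card ≤ 3)
    (hIH : I ⊆ H) (hInt : IsIntersecting I) (hstar : ∀ x, ¬ I ⊆ star H x)
    (htwo : ∀ A ∈ I, 2 ≤ A.card) {a b c : Fin n} (hab : a ≠ b) (hac : a ≠ c)
    (hbc : b ≠ c) (h1 : {a, b} ∈ I) (h2 : {a, c} ∈ I) :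
    I.card < maxStar H ∨ (I.card ≤ maxStar H ∧ IsTriangleException H) := by
  by_cases h3 : {b, c} ∈ I
  · exact card_le_of_triangle hdown hthree hIH hInt hab hac hbc h1 h2 h3
  have hsingle : {a} ∉ I := fun h => by simpa using htwo _ h
  have hmiss : ∀ B ∈ I, a ∉ B → b ∈ B ∧ c ∈ B := by
    intro B hB haB
    obtain ⟨x, hx⟩ := hInt _ h1 B hB
    obtain ⟨y, hy⟩ := hInt _ h2 B hB
    simp only [Finset.mem_inter, Finset.mem_insert, Finset.mem_singleton] at hx hy
    grind
  obtain ⟨E, hE, haE⟩ : ∃ E ∈ I, a ∉ E := by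
    by_contra! h
    exact hstar a fun A hA => mem_star.2 ⟨hIH hA, h A hA⟩
  have hbcH : {b, c} ∈ H := by
    refine hdown E (hIH hE) _ ?_
    have := hmiss E hE haE
    intro z hz
    simp only [Finset.mem_insert, Finset.mem_singleton] at hz
    grind
  have hthird : ∀ B ∈ I, a ∉ B → ∀ m ∈ B, m ≠ b → m ≠ c → B = {b, c, m} := by
    intro B hB haB m hm hmb hmc
    have := hmiss B hB haB
    refine (Finset.eq_of_subset_of_card_le ?_ ?_).symm
    · intro z hz
      simp only [Finset.mem_insert, Finset.mem_singleton] at hz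
      grind
    · rw [Finset.card_eq_three.2 ⟨b, c, m, hbc, hmb.symm, hmc.symm, rfl⟩]
      exact hthree B (hIH hB)
  -- If `{b, c}` can be added, the triangle bound for the enlarged family is strict for `I`.
  by_cases hall : ∀ A ∈ I, (A ∩ {b, c}).Nonempty
  · have h := card_le_of_triangle (I := insert {b, c} I) hdown hthree
      (Finset.insert_subset hbcH hIH) (isIntersecting_insert hInt (by simp) hall) hab hac hbc
      (by simp [h1]) (by simp [h2]) (by simp)
    rw [Finset.card_insert_of_notMem h3] at h
    left
    rcases h with h | h <;> omega
  push Not at hall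
  obtain ⟨A, hA, hAbc⟩ := hall
  have hbA : b ∉ A := fun h => by
    have : b ∈ A ∩ {b, c} := by simp [h]
    simp [hAbc] at this
  have hcA : c ∉ A := fun h => by
    have : c ∈ A ∩ {b, c} := by simp [h]
    simp [hAbc] at this
  have haA : a ∈ A := by
    by_contra h
    exact hbA (hmiss A hA h).1
  -- A member missing `a` is `{b, c, m}` with `m` in `A.erase a`, so these points bound the missed
  -- members.
  by_cases hfree : A.erase a ⊆ freeNbrs I a
  · left
    refine card_lt_maxStar_of_missed_le (x := a) hdown hIH ⟨A, hA⟩ hsingle ?_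
    refine le_trans ?_ (Finset.card_le_card hfree)
    refine (Finset.card_le_card (t := (A.erase a).image (fun m => {b, c, m})) ?_).trans
      Finset.card_image_le
    intro B hB
    rw [mem_missed] at hB
    obtain ⟨m, hm⟩ := hInt A hA B hB.1
    rw [Finset.mem_inter] at hm
    refine Finset.mem_image.2 ⟨m, Finset.mem_erase.2 ⟨?_, hm.1⟩, ?_⟩
    · rintro rfl; exact hB.2 hm.2
    · refine (hthird B hB.1 hB.2 m hm.2 ?_ ?_).symm
      · rintro rfl; exact hbA hm.1
      · rintro rfl; exact hcA hm.1
  obtain ⟨d, hdA, hd⟩ := Finset.not_subset.1 hfree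
  rw [Finset.mem_erase] at hdA
  have hdb : d ≠ b := by rintro rfl; exact hbA hdA.2
  have hdc : d ≠ c := by rintro rfl; exact hcA hdA.2
  have h4 : {a, d} ∈ I := by
    by_contra h
    exact hd (mem_freeNbrs.2 ⟨hdA.1, h, A, hA, haA, hdA.2⟩)
  have hmiss' : ∀ B ∈ I, a ∉ B → B = {b, c, d} := by
    intro B hB haB
    refine hthird B hB haB d ?_ hdb hdc
    obtain ⟨x, hx⟩ := hInt _ h4 B hB
    simp only [Finset.mem_inter, Finset.mem_insert, Finset.mem_singleton] at hx
    grind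
  have hbcd : {b, c, d} ∈ I := hmiss' E hE haE ▸ hE
  -- Only `{b, c, d}` misses `a`, so a single free point suffices. With none, `I` lives on `{a, b,
  -- c, d}`, and replacing `{a, d}` by `{b, c}` yields a triangle without changing the size.
  rcases (freeNbrs I a).eq_empty_or_nonempty with hf | hf
  · have hQ : ∀ B ∈ I, ∀ v ∈ B, v = a ∨ v = b ∨ v = c ∨ v = d := by
      intro B hB v hv
      by_cases haB : a ∈ B
      · by_cases hva : v = a
        · exact Or.inl hva
        · have hav : {a, v} ∈ I := by
            by_contra h
            have : v ∈ freeNbrs I a := mem_freeNbrs.2 ⟨hva, h, B, hB, haB, hv⟩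
            simp [hf] at this
          obtain ⟨x, hx⟩ := hInt _ hav _ hbcd
          simp only [Finset.mem_inter, Finset.mem_insert, Finset.mem_singleton] at hx
          grind
      · rw [hmiss' B hB haB] at hv
        simp only [Finset.mem_insert, Finset.mem_singleton] at hv
        exact Or.inr hv
    have hne : ∀ v, v ≠ a → v ≠ d → ({a, v} : Finset (Fin n)) ≠ {a, d} := by
      intro v hva hvd h
      have : v ∈ ({a, d} : Finset (Fin n)) := by rw [← h]; simp
      simp [hva, hvd] at this
    have hJ : IsIntersecting (insert {b, c} (I.erase {a, d})) := by
      refine isIntersecting_insert (fun A hA B hB => hInt A (Finset.mem_of_mem_erase hA) B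
        (Finset.mem_of_mem_erase hB)) (by simp) ?_
      intro B hB
      rw [Finset.mem_erase] at hB
      by_contra hemp
      have hsub : B ⊆ {a, d} := by
        intro v hv
        have h5 := hQ B hB.2 v hv
        have h6 : ¬ (v = b ∨ v = c) := fun h => hemp ⟨v, by simp [hv, h]⟩
        simp only [Finset.mem_insert, Finset.mem_singleton]
        tauto
      refine hB.1 (Finset.eq_of_subset_of_card_le hsub ?_)
      rw [Finset.card_pair hdA.1.symm]
      exact htwo B hB.2
    have h := card_le_of_triangle hdown hthree
      (Finset.insert_subset hbcH ((Finset.erase_subset _ _).trans hIH)) hJ hab hac hbc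
      (by simp [h1, hne b hab.symm hdb.symm]) (by simp [h2, hne c hac.symm hdc.symm]) (by simp)
    rwa [Finset.card_insert_of_notMem (fun h => h3 (Finset.mem_of_mem_erase h)),
      Finset.card_erase_add_one h4] at h
  · left
    refine card_lt_maxStar_of_missed_le (x := a) hdown hIH ⟨A, hA⟩ hsingle ?_
    refine le_trans ?_ hf.card_pos
    rw [Finset.card_le_one]
    intro B hB C hC
    rw [mem_missed] at hB hC
    rw [hmiss' B hB.1 hB.2, hmiss' C hC.1 hC.2]

/-! ### The bound for all intersecting families -/

/-- An intersecting family that is not part of a star is smaller than the largest star, unless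
`H` is a triangle exception. -/
theorem card_le_of_not_subset_star {H I : Finset (Finset (Fin n))}
    (hdown : ∀ A ∈ H, ∀ B : Finset (Fin n), B ⊆ A → B ∈ H) (hthree : ∀ A ∈ H, A.card ≤ 3)
    (hn : 1 ≤ n) (hIH : I ⊆ H) (hInt : IsIntersecting I) (hstar : ∀ x, ¬ I ⊆ star H x) :
    I.card < maxStar H ∨ (I.card ≤ maxStar H ∧ IsTriangleException H) := by
  have htwo : ∀ A ∈ I, 2 ≤ A.card := by
    intro A hA
    have hne := hInt A hA A hA
    rw [Finset.inter_self] at hne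
    have hpos := hne.card_pos
    by_contra hlt
    obtain ⟨x, rfl⟩ := Finset.card_eq_one.1 (show A.card = 1 by omega)
    refine hstar x fun B hB => mem_star.2 ⟨hIH hB, ?_⟩
    obtain ⟨y, hy⟩ := hInt _ hA B hB
    simp only [Finset.mem_inter, Finset.mem_singleton] at hy
    exact hy.1 ▸ hy.2
  have hsingle : ∀ x, {x} ∉ I := fun x h => by simpa using htwo _ h
  have hne : I.Nonempty := by
    rw [Finset.nonempty_iff_ne_empty]
    rintro rfl
    exact hstar ⟨0, hn⟩ (Finset.empty_subset _)
  by_cases hpairs : ∃ e ∈ I, ∃ f ∈ I, e.card = 2 ∧ f.card = 2 ∧ e ≠ f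
  · obtain ⟨e, he, f, hf, he2, hf2, hef⟩ := hpairs
    obtain ⟨a, ha⟩ := hInt e he f hf
    rw [Finset.mem_inter] at ha
    obtain ⟨b, hb⟩ := Finset.card_eq_one.1
      (show (e.erase a).card = 1 by rw [Finset.card_erase_of_mem ha.1, he2])
    obtain ⟨c, hc⟩ := Finset.card_eq_one.1
      (show (f.erase a).card = 1 by rw [Finset.card_erase_of_mem ha.2, hf2])
    have hba : b ∈ e.erase a := by rw [hb]; simp
    have hca : c ∈ f.erase a := by rw [hc]; simp
    have he' : {a, b} = e := by rw [← Finset.insert_erase ha.1, hb]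
    have hf' : {a, c} = f := by rw [← Finset.insert_erase ha.2, hc]
    refine card_le_of_two_pairs hdown hthree hIH hInt hstar htwo
      (Finset.ne_of_mem_erase hba).symm (Finset.ne_of_mem_erase hca).symm ?_
      (he' ▸ he) (hf' ▸ hf)
    rintro rfl
    exact hef (he'.symm.trans hf')
  push Not at hpairs
  left
  obtain ⟨z, hz⟩ : ∃ z, (missed I z).card ≤ (freeNbrs I z).card := by
    by_cases h2 : ∃ e ∈ I, e.card = 2
    · obtain ⟨e, he, he2⟩ := h2
      obtain ⟨x, y, hxy, rfl⟩ := Finset.card_eq_two.1 he2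
      refine NearlyCovered.exists_missed_le hxy hInt ⟨fun A hA => ?_, Or.inl fun A hA => ?_⟩
      · have h3 := htwo A hA
        have h4 := hthree A (hIH hA)
        by_cases h5 : A.card = 2
        · exact Or.inr (hpairs A hA _ he h5 he2)
        · left; omega
      · obtain ⟨w, hw⟩ := hInt _ he A hA
        simp only [Finset.mem_inter, Finset.mem_insert, Finset.mem_singleton] at hw
        rcases hw with ⟨rfl | rfl, hw⟩
        exacts [Or.inl hw, Or.inr hw]
    · push Not at h2
      refine exists_missed_le_of_triples hInt (fun A hA => ?_) hne
      have h3 := htwo A hA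
      have h4 := hthree A (hIH hA)
      have h5 := h2 A hA
      omega
  exact card_lt_maxStar_of_missed_le hdown hIH hne (hsingle z) hz

theorem isIntersecting_star (H : Finset (Finset (Fin n))) (x : Fin n) :
    IsIntersecting (star H x) := fun _ hA _ hB =>
  ⟨x, Finset.mem_inter.2 ⟨(mem_star.1 hA).2, (mem_star.1 hB).2⟩⟩

theorem isEKR_of_downset {H : Finset (Finset (Fin n))}
    (hdown : ∀ A ∈ H, ∀ B : Finset (Fin n), B ⊆ A → B ∈ H) (hthree : ∀ A ∈ H, A.card ≤ 3)
    (hn : 1 ≤ n) : IsEKR H := by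
  apply le_antisymm
  · refine Finset.sup_le fun I hI => ?_
    rw [Finset.mem_filter, Finset.mem_powerset] at hI
    by_cases h : ∃ x, I ⊆ star H x
    · obtain ⟨x, hx⟩ := h
      exact (Finset.card_le_card hx).trans (card_star_le_maxStar H x)
    · push Not at h
      rcases card_le_of_not_subset_star hdown hthree hn hI.1 hI.2 h with h | h
      exacts [h.le, h.1]
  · refine Finset.sup_le fun x _ => ?_
    exact Finset.le_sup (f := Finset.card) (Finset.mem_filter.2
      ⟨Finset.mem_powerset.2 (Finset.filter_subset _ _), isIntersecting_star H x⟩)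

/-! ### The exceptional configurations -/

/-- Remove a point `d` from the 4-set and take `M = {d}`: the value 7 is `3 * 1 + 4`, as in case
(b). -/
theorem isTriangleException_of_isFourSetException {H : Finset (Finset (Fin n))}
    (hdown : ∀ A ∈ H, ∀ B : Finset (Fin n), B ⊆ A → B ∈ H) (h : IsFourSetException H) :
    IsTriangleException H := by
  obtain ⟨Q, hQ, hQH, -, hmax⟩ := h
  obtain ⟨d, hd⟩ := Finset.card_pos.1 (show 0 < Q.card by omega)
  have hK : (Q.erase d).card = 3 := by rw [Finset.card_erase_of_mem hd, hQ]
  have hMK : Disjoint {d} (Q.erase d) := by simp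
  have hcard := card_triangleFamily hK hMK
  rw [Finset.card_singleton] at hcard
  refine ⟨Q.erase d, {d}, hK, hMK, ?_, Or.inr ⟨?_, by omega, by simp [hcard]⟩⟩
  · intro Z hZ
    have hKH : Q.erase d ∈ H := hQH (Finset.mem_powersetCard.2 ⟨Finset.erase_subset _ _, hK⟩)
    rcases Finset.mem_union.1 hZ with hZ | hZ
    · exact hdown _ hKH _ (Finset.mem_powersetCard.1 hZ).1
    · have h1 := Finset.mem_powersetCard.1 (Finset.mem_filter.1 hZ).1
      refine hQH (Finset.mem_powersetCard.2 ⟨h1.1.trans ?_, h1.2⟩)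
      exact Finset.union_subset (Finset.erase_subset _ _) (by simpa using hd)
  · exact hQH (Finset.mem_powersetCard.2 ⟨Finset.erase_subset _ _, hK⟩)

theorem isIntersecting_of_two_le_inter {I : Finset (Finset (Fin n))} {K : Finset (Fin n)}
    (hK : K.card = 3) (h : ∀ A ∈ I, 2 ≤ (A ∩ K).card) : IsIntersecting I := by
  intro A hA B hB
  by_contra hemp
  have hdis : Disjoint (A ∩ K) (B ∩ K) := by
    rw [Finset.disjoint_left]
    intro z hz hz'
    exact hemp ⟨z, Finset.mem_inter.2 ⟨(Finset.mem_inter.1 hz).1, (Finset.mem_inter.1 hz').1⟩⟩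
  have h1 := Finset.card_le_card
    (Finset.union_subset (Finset.inter_subset_right (s₁ := A) (s₂ := K))
      (Finset.inter_subset_right (s₁ := B) (s₂ := K)))
  rw [Finset.card_union_of_disjoint hdis, hK] at h1
  have h2 := h A hA
  have h3 := h B hB
  omega

/-- The triangle family, with `K` added in case (b), is intersecting and as large as a star, but no
point lies in all three pairs of `K`. -/
theorem not_isStrictlyEKR_of_isTriangleException {H : Finset (Finset (Fin n))}
    (hekr : IsEKR H) (h : IsTriangleException H) : ¬ IsStrictlyEKR H := by
  obtain ⟨K, M, hK, hMK, hsub, hcase⟩ := h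
  intro hstrict
  have htwo : ∀ Z ∈ triangleFamily K M, (Z ∩ K).card = 2 := by
    intro Z hZ
    rcases Finset.mem_union.1 hZ with hZ | hZ
    · rw [Finset.mem_powersetCard] at hZ
      rw [Finset.inter_eq_left.2 hZ.1, hZ.2]
    · exact (Finset.mem_filter.1 hZ).2
  have hKnot : K ∉ triangleFamily K M := fun h => by
    have := htwo K h
    rw [Finset.inter_self] at this
    omega
  obtain ⟨I, hI, hIH, hInt, hcard⟩ : ∃ I, triangleFamily K M ⊆ I ∧ I ⊆ H ∧ IsIntersecting I ∧
      I.card = maxStar H := by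
    rcases hcase with ⟨-, hmax, -⟩ | ⟨hKH, hmax, -⟩
    · exact ⟨_, subset_rfl, hsub,
        isIntersecting_of_two_le_inter hK fun Z hZ => (htwo Z hZ).ge, hmax.symm⟩
    · refine ⟨insert K (triangleFamily K M), Finset.subset_insert _ _,
        Finset.insert_subset hKH hsub, isIntersecting_of_two_le_inter hK fun Z hZ => ?_, ?_⟩
      · rcases Finset.mem_insert.1 hZ with rfl | hZ
        · rw [Finset.inter_self]; omega
        · exact (htwo Z hZ).ge
      · rw [Finset.card_insert_of_notMem hKnot, hmax]
  obtain ⟨x, hx⟩ := hstrict I hIH hInt (hcard.trans (Eq.symm hekr))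
  have hcover : ∀ e ∈ K.powersetCard 2, x ∈ e := by
    intro e he
    have h1 : e ∈ I := hI (Finset.mem_union_left _ he)
    rw [hx] at h1
    exact (mem_star.1 h1).2
  obtain ⟨e, he⟩ := Finset.card_pos.1 (show 0 < (K.powersetCard 2).card by
    rw [Finset.card_powersetCard, hK]; decide)
  have hxK : x ∈ K := (Finset.mem_powersetCard.1 he).1 (hcover e he)
  have := hcover (K.erase x) (Finset.mem_powersetCard.2
    ⟨Finset.erase_subset _ _, by rw [Finset.card_erase_of_mem hxK, hK]⟩)
  simp at this

end Chvatal

theorem mainTheorem1 (n : ℕ) (hn : 1 ≤ n) (H : Finset (Finset (Fin n)))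
    (hdown : ∀ A ∈ H, ∀ B : Finset (Fin n), B ⊆ A → B ∈ H)
    (hthree : ∀ A ∈ H, A.card ≤ 3) :
    Chvatal.IsEKR H ∧
      (Chvatal.IsStrictlyEKR H ↔
        ¬ (Chvatal.IsFourSetException H ∨ Chvatal.IsTriangleException H)) := by
  have hekr := Chvatal.isEKR_of_downset hdown hthree hn
  refine ⟨hekr, fun hstrict hexc => ?_, fun hexc I hIH hInt hcard => ?_⟩
  · refine Chvatal.not_isStrictlyEKR_of_isTriangleException hekr ?_ hstrict
    exact hexc.elim (Chvatal.isTriangleException_of_isFourSetException hdown) id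
  · have hcard : I.card = Chvatal.maxStar H := hcard.trans hekr
    by_cases h : ∃ x, I ⊆ Chvatal.star H x
    · obtain ⟨x, hx⟩ := h
      refine ⟨x, Finset.eq_of_subset_of_card_le hx ?_⟩
      rw [hcard]
      exact Chvatal.card_star_le_maxStar H x
    · push Not at h
      rcases Chvatal.card_le_of_not_subset_star hdown hthree hn hIH hInt h with h | h
      · omega
      · exact absurd (Or.inr h.2) hexc
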